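/- Let $(X,d)$ be a complete metric space equipped with a Borel measure $\mu$ that is doubling (balls have positive finite measure and $\mu(B(x,2r))\le C_D\,\mu(B(x,r))$ for all $x\in X$, $r>0$) and supports a $2$-Poincaré inequality: there are constants $C_P,\lambda\ge 1$ with $$\frac1{\mu(B)}\int_B|f-f_B|\,d\mu\le C_P\,\mathrm{rad}(B)\Big(\frac1{\mu(\lambda B)}\int_{\lambda B}g^2\,d\mu\Big)^{1/2},\qquad f_B:=\frac1{\mu(B)}\int_Bf\,d\mu,$$ for all balls $B$, all $f:X\to\mathbb R$ integrable on balls and all upper gradients $g$ of $f$. Here a Borel function $g:X\to[0,\infty]$ is an upper gradient of $f$ if $|f(\gamma(b))-f(\gamma(a))|\le\int_\gamma g\,ds$ for every rectifiable curve $\gamma:[a,b]\to X$. Let $N^{1,2}(X)$ be the space of measurable $f:X\to\mathbb R$ with $\big(\int_X|f|^2d\mu\big)^{1/2}+\inf_g\big(\int_Xg^2d\mu\big)^{1/2}<\infty$, the infimum being over all upper gradients $g$ of $f$. For $E\subset X$ let $\mathrm{Cap}_2(E)=\inf_f\big(\int_X|f|^2d\mu+\inf_g\int_Xg^2d\mu\big)$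 over measurable $f$ with $f\ge1$ on $E$ and upper gradients $g$ of $f$. Let $\Omega\subset X$ be a bounded domain (nonempty, open, connected) with $\mu(X\setminus\Omega)>0$, and let $N^{1,2}_0(\Omega)$ be the set of $f\in N^{1,2}(X)$ with $\mathrm{Cap}_2(\{x\in X\setminus\Omega: f(x)\neq0\})=0$. For $r>0$ let $X_r$ be a maximal $r$-separated subset of $X$ (distinct points have distance at least $r$). For distinct $\bar x,\bar y\in X_r$ write $\bar x\sim\bar y$ if $d(\bar x,\bar y)\le3r$. Let $\mu_r$ be the measure on $X_r$ with $\mu_r(\{\bar x\})=\mu(B(\bar x,r/4))$, and write $L^2(X_r)=L^2(X_r,\mu_r)$. For $v\in L^1_{loc}(X)$ put $v_r(\bar x)=\frac1{\mu(B(\bar x,r/4))}\int_{B(\bar x,r/4)}v\,d\mu$. Let $\Omega_r=\{\bar x\in X_r: B(\bar x,20r)\subset\Omega\}$, and let $D^{1,2}_0(\Omega_r)$ be the set of all $u:X_r\to\mathbb R$ with $u=0$ on $X_r\setminus\Omega_r$. Then there is a constant $C\ge1$ such that for every $r>0$ and every maximal $r$-separated set $X_r\subset X$ there is a map $P_r$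 from functions $X_r\to\mathbb R$ to functions $X\to\mathbb R$ that maps $L^2(X_r)$ into $N^{1,2}(X)$ and satisfies: (a) for every $u:X_r\to\mathbb R$, $P_ru$ is locally integrable and $(P_ru)_r(\bar x)=u(\bar x)$ for all $\bar x\in X_r$; (b) for every $u:X_r\to\mathbb R$, $$\inf_g\int_Xg^2\,d\mu\le C\sum_{\bar x\in X_r}\ \sum_{\bar y\in X_r,\ \bar y\sim\bar x}\frac{|u(\bar y)-u(\bar x)|^2}{r^2}\,\mu_r(\{\bar x\}),$$ the infimum being over all upper gradients $g$ of $P_ru$; the same bound holds for $\int_Xg_{P_ru}^2\,d\mu$ when $g_{P_ru}$ is a minimal $2$-weak upper gradient of $P_ru$, that is, a $2$-weak upper gradient in $L^2(X)$ (the upper gradient inequality holds outside a family of curves of zero $2$-modulus) that is $\mu$-a.e. at most every other $2$-weak upper gradient of $P_ru$ in $L^2(X)$; (c) $P_ru\in N^{1,2}_0(\Omega)$ for every $u\in D^{1,2}_0(\Omega_r)$. -/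

import Mathlib

open MeasureTheory Set
open scoped ENNReal

noncomputable section

namespace GraphApprox

/-! ### Curves, line integrals and upper gradients -/

/-- A rectifiable curve in `X`: a continuous map on a compact interval `[a, b]` with finite length.
Only the values of `toFun` on `[a, b]` matter. -/
structure RectCurve (X : Type*) [MetricSpace X] where
  toFun : ℝ → X
  a : ℝ
  b : ℝ
  le : a ≤ b
  continuousOn : ContinuousOn toFun (Icc a b)
  rectifiable : eVariationOn toFun (Icc a b) ≠ ∞

namespace RectCurve

variable {X : Type*} [MetricSpace X]

/-- The length of a rectifiable curve. -/
def length (γ : RectCurve X) : ℝ := (eVariationOn γ.toFun (Icc γ.a γ.b)).toReal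

/-- The arc-length parametrization `[0, length γ] → X` of a rectifiable curve. -/
def arcLength (γ : RectCurve X) : ℝ → X :=
  naturalParameterization γ.toFun (Icc γ.a γ.b) γ.a

/-- The line integral `∫_γ g ds`, computed in the arc-length parametrization. -/
def lineIntegral (γ : RectCurve X) (g : X → ℝ≥0∞) : ℝ≥0∞ :=
  ∫⁻ t in Icc 0 γ.length, g (γ.arcLength t)

end RectCurve

/-- The upper gradient inequality `|f(γ(b)) - f(γ(a))| ≤ ∫_γ g ds` for one curve. -/
def UpperGradientIneq {X : Type*} [MetricSpace X] (f : X → ℝ) (g : X → ℝ≥0∞)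
    (γ : RectCurve X) : Prop :=
  ENNReal.ofReal |f (γ.toFun γ.b) - f (γ.toFun γ.a)| ≤ γ.lineIntegral g

/-- `g : X → [0, ∞]` is an upper gradient of `f : X → ℝ`. -/
def IsUpperGradient {X : Type*} [MetricSpace X] [MeasurableSpace X]
    (f : X → ℝ) (g : X → ℝ≥0∞) : Prop :=
  Measurable g ∧ ∀ γ : RectCurve X, UpperGradientIneq f g γ

/-- The `p`-modulus of a family of curves. -/
def modulus {X : Type*} [MetricSpace X] [MeasurableSpace X] (p : ℝ) (μ : Measure X)
    (Γ : Set (RectCurve X)) : ℝ≥0∞ :=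
  ⨅ (ρ : X → ℝ≥0∞) (_ : Measurable ρ ∧ ∀ γ ∈ Γ, 1 ≤ γ.lineIntegral ρ), ∫⁻ x, ρ x ^ p ∂μ

/-- `g` is a `p`-weak upper gradient of `f`: the upper gradient inequality holds for all curves
outside a family of zero `p`-modulus. -/
def IsWeakUpperGradient {X : Type*} [MetricSpace X] [MeasurableSpace X] (p : ℝ) (μ : Measure X)
    (f : X → ℝ) (g : X → ℝ≥0∞) : Prop :=
  Measurable g ∧ ∃ Γ : Set (RectCurve X), modulus p μ Γ = 0 ∧
    ∀ γ : RectCurve X, γ ∉ Γ → UpperGradientIneq f g γ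

/-- `g` is a minimal `p`-weak upper gradient of `f`: it lies in `L^p` and is almost everywhere
at most any other `p`-weak upper gradient of `f` in `L^p`. -/
def IsMinimalWeakUpperGradient {X : Type*} [MetricSpace X] [MeasurableSpace X] (p : ℝ)
    (μ : Measure X) (f : X → ℝ) (g : X → ℝ≥0∞) : Prop :=
  IsWeakUpperGradient p μ f g ∧ ∫⁻ x, g x ^ p ∂μ < ∞ ∧
    ∀ h : X → ℝ≥0∞, IsWeakUpperGradient p μ f h → ∫⁻ x, h x ^ p ∂μ < ∞ → ∀ᵐ x ∂μ, g x ≤ h x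

/-- The upper gradient energy `inf_g ∫ g^p dμ`, the infimum being over all upper gradients. -/
def upperGradientEnergy {X : Type*} [MetricSpace X] [MeasurableSpace X] (p : ℝ) (μ : Measure X)
    (f : X → ℝ) : ℝ≥0∞ :=
  ⨅ (g : X → ℝ≥0∞) (_ : IsUpperGradient f g), ∫⁻ x, g x ^ p ∂μ

/-! ### Newton-Sobolev spaces -/

/-- The norm of `N^{1,p}(X)`, with values in `[0, ∞]`. -/
def newtonSobolevNorm {X : Type*} [MetricSpace X] [MeasurableSpace X] (p : ℝ) (μ : Measure X)
    (f : X → ℝ) : ℝ≥0∞ :=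
  (∫⁻ x, ENNReal.ofReal |f x| ^ p ∂μ) ^ (1 / p) +
    ⨅ (g : X → ℝ≥0∞) (_ : IsUpperGradient f g), (∫⁻ x, g x ^ p ∂μ) ^ (1 / p)

/-- `f ∈ N^{1,p}(X)`. -/
def MemNewtonSobolev {X : Type*} [MetricSpace X] [MeasurableSpace X] (p : ℝ) (μ : Measure X)
    (f : X → ℝ) : Prop :=
  AEMeasurable f μ ∧ newtonSobolevNorm p μ f < ∞

/-- The Sobolev `p`-capacity of a set. -/
def capacity {X : Type*} [MetricSpace X] [MeasurableSpace X] (p : ℝ) (μ : Measure X)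
    (E : Set X) : ℝ≥0∞ :=
  ⨅ (f : X → ℝ) (_ : AEMeasurable f μ ∧ ∀ x ∈ E, 1 ≤ f x),
    (∫⁻ x, ENNReal.ofReal |f x| ^ p ∂μ) + upperGradientEnergy p μ f

/-- `f ∈ N^{1,p}_0(Ω)`: `f ∈ N^{1,p}(X)` and `f = 0` on `X \ Ω` outside a set of zero
`p`-capacity. -/
def MemNewtonSobolevZero {X : Type*} [MetricSpace X] [MeasurableSpace X] (p : ℝ) (μ : Measure X)
    (Ω : Set X) (f : X → ℝ) : Prop :=
  MemNewtonSobolev p μ f ∧ capacity p μ {x | x ∉ Ω ∧ f x ≠ 0} = 0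

/-! ### Doubling measures and Poincaré inequalities -/

/-- `μ` is a doubling measure: balls have positive finite measure, and
`μ(B(x, 2r)) ≤ C_D μ(B(x, r))` for all balls. -/
def IsDoubling {X : Type*} [MetricSpace X] [MeasurableSpace X] (μ : Measure X) : Prop :=
  (∀ (x : X) (r : ℝ), 0 < r → 0 < μ (Metric.ball x r) ∧ μ (Metric.ball x r) < ∞) ∧
    ∃ CD : ℝ, 1 ≤ CD ∧ ∀ (x : X) (r : ℝ), 0 < r →
      μ (Metric.ball x (2 * r)) ≤ ENNReal.ofReal CD * μ (Metric.ball x r)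

/-- `(X, d, μ)` supports a `p`-Poincaré inequality. The functions are integrable on balls, so that
their averages make sense. -/
def SupportsPoincare {X : Type*} [MetricSpace X] [MeasurableSpace X] (p : ℝ)
    (μ : Measure X) : Prop :=
  ∃ CP lam : ℝ, 1 ≤ CP ∧ 1 ≤ lam ∧
    ∀ (f : X → ℝ) (g : X → ℝ≥0∞),
      (∀ (x : X) (r : ℝ), 0 < r → IntegrableOn f (Metric.ball x r) μ) → IsUpperGradient f g →
      ∀ (x : X) (r : ℝ), 0 < r →
        (⨍⁻ y in Metric.ball x r,
            ENNReal.ofReal |f y - ⨍ z in Metric.ball x r, f z ∂μ| ∂μ) ≤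
          ENNReal.ofReal (CP * r) *
            (⨍⁻ y in Metric.ball x (lam * r), g y ^ p ∂μ) ^ (1 / p)

/-! ### Graph approximations -/

/-- `A` is `r`-separated: distinct points of `A` have distance at least `r`. -/
def IsSeparatedSet {X : Type*} [MetricSpace X] (r : ℝ) (A : Set X) : Prop :=
  ∀ x ∈ A, ∀ y ∈ A, x ≠ y → r ≤ dist x y

/-- `A` is a maximal `r`-separated set, that is, a discretization of `X` at scale `r`. -/
def IsDiscretization {X : Type*} [MetricSpace X] (r : ℝ) (A : Set X) : Prop :=
  Maximal (IsSeparatedSet r) A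

/-- The graph with vertex set `A` in which distinct `x, y` are neighbors if `d(x, y) ≤ 3r`. -/
def proximityGraph {X : Type*} [MetricSpace X] (r : ℝ) (A : Set X) : SimpleGraph A where
  Adj x y := x ≠ y ∧ dist (x : X) (y : X) ≤ 3 * r
  symm := ⟨fun _ _ h => ⟨h.1.symm, dist_comm (α := X) _ _ ▸ h.2⟩⟩
  loopless := ⟨fun _ h => h.1 rfl⟩

/-- The measure `μ_r` on the vertex set `A`, with `μ_r({x}) = μ(B(x, r/4))`. -/
def discreteMeasure {X : Type*} [MetricSpace X] [MeasurableSpace X] (μ : Measure X) (r : ℝ)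
    (A : Set X) : Measure A :=
  Measure.sum fun x : A => μ (Metric.ball (x : X) (r / 4)) • Measure.dirac x

/-- The ball average `v_r(x) = ⨍_{B(x, r/4)} v dμ` for `x ∈ A`. -/
def ballAverage {X : Type*} [MetricSpace X] [MeasurableSpace X] (μ : Measure X) (r : ℝ)
    (A : Set X) (v : X → ℝ) (x : A) : ℝ :=
  ⨍ y in Metric.ball (x : X) (r / 4), v y ∂μ

/-- The graph energy `∑_x ∑_{y ∼ x} |u(y) - u(x)|² / r² μ_r({x})`, with values in `[0, ∞]`. -/
def graphEnergy {X : Type*} [MetricSpace X] [MeasurableSpace X] (μ : Measure X) (r : ℝ)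
    (A : Set X) (u : A → ℝ) : ℝ≥0∞ :=
  ∑' x : A, ∑' y : (proximityGraph r A).neighborSet x,
    ENNReal.ofReal (|u y - u x| ^ 2 / r ^ 2) * discreteMeasure μ r A {x}

/-- The discretization `Ω_r` of `Ω`: the vertices `x` with `B(x, 20r) ⊆ Ω`. -/
def discreteDomain {X : Type*} [MetricSpace X] (r : ℝ) (A : Set X) (Ω : Set X) : Set A :=
  {x | Metric.ball (x : X) (20 * r) ⊆ Ω}

/-- `u ∈ D^{1,2}_0(Ω_r)`: `u` vanishes at the vertices outside `Ω_r`. -/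
def MemDiscreteZero {X : Type*} [MetricSpace X] (r : ℝ) (A : Set X) (Ω : Set X)
    (u : A → ℝ) : Prop :=
  ∀ x : A, x ∉ discreteDomain r A Ω → u x = 0

end GraphApprox

end

open MeasureTheory Set Filter Topology
open scoped ENNReal NNReal

namespace GraphApprox

noncomputable section

section Curves

/-! ### Arc-length parametrizations -/

/-! The map `P_r` is `extension`: a partition-of-unity average whose weight at `z` is a vertex's
lead, up to `r / 4`, over the nearest-vertex distance. Close to a vertex only that vertex has
positive weight, so the extension is constant there and reproduces `u` exactly. By maximality all
contributing vertices lie within `5r/4` of `z`, which gives locality and hence zero boundary values.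

For the energy, the weights are `2`-Lipschitz and their sum is at least `r / 8`. After subtracting
`u x`, which normalized weights permit, the quotient on `B(x, 3r/2)` has a Lipschitz constant
controlled by the differences of `u` along edges at `x` (`abs_extension_sub_le`). The square root of
the sum over `x` of these squared constants, each cut off to its ball, is an upper gradient by
`upperGradientIneq_of_lipschitz_on_balls`. Doubling bounds the number of neighbors and compares
balls of radii `3r/2` and `r/4`, so integrating the square gives the graph energy. -/

/-- The variation function of a continuous curve of locally bounded variation is continuous. -/
theorem continuousOn_variationOnFromTo {E : Type*} [PseudoMetricSpace E] {f : ℝ → E} {s : Set ℝ}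
    (hf : LocallyBoundedVariationOn f s) (hc : ContinuousOn f s) {a : ℝ} (ha : a ∈ s) :
    ContinuousOn (variationOnFromTo f s a) s := by
  intro b hb
  -- One-sided limits of the variation differ from its value at `b` by the jumps of `f`, which
  -- continuity makes zero.
  have hl := variationOnFromTo.tendsto_left ha hb hf
    ((hc b hb).mono_left (nhdsWithin_mono _ inter_subset_left))
  have hr := variationOnFromTo.tendsto_right ha hb hf
    ((hc b hb).mono_left (nhdsWithin_mono _ inter_subset_left))
  rw [dist_self, sub_zero] at hl
  rw [dist_self, add_zero] at hr
  have hs : s = (s ∩ Iio b ∪ s ∩ Ioi b) ∪ {b} := by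
    ext x
    simp only [mem_union, mem_inter_iff, mem_Iio, mem_Ioi, mem_singleton_iff]
    constructor
    · intro hx
      rcases lt_trichotomy x b with h | h | h
      · exact Or.inl (Or.inl ⟨hx, h⟩)
      · exact Or.inr h
      · exact Or.inl (Or.inr ⟨hx, h⟩)
    · rintro ((h | h) | rfl)
      · exact h.1
      · exact h.1
      · exact hb
  have key : Tendsto (variationOnFromTo f s a) (𝓝[(s ∩ Iio b ∪ s ∩ Ioi b) ∪ {b}] b)
      (𝓝 (variationOnFromTo f s a b)) := by
    rw [nhdsWithin_union, nhdsWithin_union, nhdsWithin_singleton]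
    exact (hl.sup hr).sup (tendsto_pure_nhds _ _)
  rw [← hs] at key
  exact key

namespace RectCurve

variable {X : Type*} [MetricSpace X] (γ : RectCurve X)

theorem locallyBoundedVariationOn : LocallyBoundedVariationOn γ.toFun (Icc γ.a γ.b) :=
  BoundedVariationOn.locallyBoundedVariationOn γ.rectifiable

theorem length_nonneg : 0 ≤ γ.length := ENNReal.toReal_nonneg

theorem variationOnFromTo_right :
    variationOnFromTo γ.toFun (Icc γ.a γ.b) γ.a γ.b = γ.length := by
  rw [variationOnFromTo.eq_of_le _ _ γ.le, inter_self, length]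

theorem arcLength_zero : γ.arcLength 0 = γ.toFun γ.a := by
  have h := edist_naturalParameterization_eq_zero γ.locallyBoundedVariationOn
    (left_mem_Icc.2 γ.le) (left_mem_Icc.2 γ.le)
  rw [variationOnFromTo.self] at h
  exact edist_eq_zero.1 h

theorem arcLength_length : γ.arcLength γ.length = γ.toFun γ.b := by
  have h := edist_naturalParameterization_eq_zero γ.locallyBoundedVariationOn
    (left_mem_Icc.2 γ.le) (right_mem_Icc.2 γ.le)
  rw [variationOnFromTo_right] at h
  exact edist_eq_zero.1 h

/-- The unit-speed property is available on the image of the variation function; by the intermediate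
value theorem this covers all of `[0, length]`. -/
theorem Icc_subset_image_variationOnFromTo :
    Icc 0 γ.length ⊆ variationOnFromTo γ.toFun (Icc γ.a γ.b) γ.a '' Icc γ.a γ.b := by
  have h := intermediate_value_Icc γ.le (continuousOn_variationOnFromTo
    γ.locallyBoundedVariationOn γ.continuousOn (left_mem_Icc.2 γ.le))
  rwa [variationOnFromTo.self, variationOnFromTo_right] at h

/-- The arc-length parametrization is `1`-Lipschitz. -/
theorem dist_arcLength_le {s t : ℝ} (hs : 0 ≤ s) (hst : s ≤ t) (ht : t ≤ γ.length) :
    dist (γ.arcLength s) (γ.arcLength t) ≤ t - s := by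
  have h := has_unit_speed_naturalParameterization γ.toFun γ.locallyBoundedVariationOn
    (left_mem_Icc.2 γ.le)
  have hs' := γ.Icc_subset_image_variationOnFromTo ⟨hs, hst.trans ht⟩
  have ht' := γ.Icc_subset_image_variationOnFromTo ⟨hs.trans hst, ht⟩
  have h1 := h hs' ht'
  have h2 : edist (γ.arcLength s) (γ.arcLength t) ≤ ENNReal.ofReal (t - s) := by
    refine (eVariationOn.edist_le _ (mem_inter hs' (left_mem_Icc.2 hst))
      (mem_inter ht' (right_mem_Icc.2 hst))).trans ?_
    simpa [RectCurve.arcLength] using h1.le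
  rw [edist_dist] at h2
  exact (ENNReal.ofReal_le_ofReal_iff (sub_nonneg.2 hst)).1 h2

end RectCurve

/-- A function that is Lipschitz on all balls of a fixed radius has every function dominating the
local Lipschitz constants as an upper gradient. -/
theorem upperGradientIneq_of_lipschitz_on_balls {X : Type*} [MetricSpace X] {f : X → ℝ}
    {g : X → ℝ≥0∞} {ε : ℝ} (hε : 0 < ε)
    (h : ∀ z, ∃ c : ℝ, 0 ≤ c ∧ ∀ p ∈ Metric.ball z ε, ENNReal.ofReal c ≤ g p ∧
      |f p - f z| ≤ c * dist p z) (γ : RectCurve X) :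
    UpperGradientIneq f g γ := by
  -- Induction on the number of arc pieces of length at most `ε / 2`. A piece starting at parameter
  -- `m` stays in the `ε`-ball about its starting point, where one constant `c` both controls the
  -- increment of `f` and bounds `g` from below.
  have key : ∀ n : ℕ, ∀ s t : ℝ, 0 ≤ s → s ≤ t → t ≤ γ.length → t - s ≤ n * (ε / 2) →
      ENNReal.ofReal |f (γ.arcLength t) - f (γ.arcLength s)| ≤
        ∫⁻ τ in Ioc s t, g (γ.arcLength τ) := by
    intro n
    induction n with
    | zero =>
      intro s t _ hst _ hn
      have : t = s := by
        rw [Nat.cast_zero, zero_mul] at hn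
        linarith
      simp [this]
    | succ n ih =>
      intro s t hs hst ht hn
      let m := max s (t - ε / 2)
      have hm1 : s ≤ m := le_max_left _ _
      have hm2 : m ≤ t := max_le hst (by linarith)
      have hm3 : t - m ≤ ε / 2 := by linarith [le_max_right s (t - ε / 2)]
      have hm4 : m - s ≤ n * (ε / 2) := by
        rcases max_choice s (t - ε / 2) with hm | hm
        · rw [show m = s from hm, sub_self]
          positivity
        · rw [show m = t - ε / 2 from hm]
          push_cast at hn
          linarith
      have h1 := ih s m hs hm1 (hm2.trans ht) hm4
      obtain ⟨c, hc, hcf⟩ := h (γ.arcLength m)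
      have hd : ∀ τ ∈ Icc m t, dist (γ.arcLength τ) (γ.arcLength m) ≤ τ - m := fun τ hτ => by
        rw [dist_comm]
        exact γ.dist_arcLength_le (hs.trans hm1) hτ.1 (hτ.2.trans ht)
      have hb : ∀ τ ∈ Icc m t, γ.arcLength τ ∈ Metric.ball (γ.arcLength m) ε := fun τ hτ => by
        rw [Metric.mem_ball]
        linarith [hd τ hτ, hτ.2]
      have h2 : ENNReal.ofReal |f (γ.arcLength t) - f (γ.arcLength m)| ≤
          ∫⁻ τ in Ioc m t, g (γ.arcLength τ) := by
        calc ENNReal.ofReal |f (γ.arcLength t) - f (γ.arcLength m)|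
            ≤ ENNReal.ofReal (c * (t - m)) := by
              refine ENNReal.ofReal_le_ofReal ((hcf _ (hb t ⟨hm2, le_rfl⟩)).2.trans ?_)
              gcongr
              exact hd t ⟨hm2, le_rfl⟩
          _ = ∫⁻ _ in Ioc m t, ENNReal.ofReal c := by
              rw [setLIntegral_const, Real.volume_Ioc, ENNReal.ofReal_mul hc]
          _ ≤ _ := setLIntegral_mono' measurableSet_Ioc
              fun τ hτ => (hcf _ (hb τ ⟨hτ.1.le, hτ.2⟩)).1
      have hu : ∫⁻ τ in Ioc s t, g (γ.arcLength τ) =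
          (∫⁻ τ in Ioc s m, g (γ.arcLength τ)) + ∫⁻ τ in Ioc m t, g (γ.arcLength τ) := by
        rw [← Ioc_union_Ioc_eq_Ioc hm1 hm2, lintegral_union measurableSet_Ioc
          (Ioc_disjoint_Ioc_of_le le_rfl)]
      rw [hu]
      refine le_trans ?_ (add_le_add h1 h2)
      rw [← ENNReal.ofReal_add (abs_nonneg _) (abs_nonneg _)]
      refine ENNReal.ofReal_le_ofReal ?_
      rw [add_comm]
      exact abs_sub_le _ _ _
  obtain ⟨n, hn⟩ := exists_nat_ge (γ.length / (ε / 2))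
  have h1 := key n 0 γ.length le_rfl γ.length_nonneg le_rfl (by
    rw [div_le_iff₀ (by positivity)] at hn
    linarith)
  rw [γ.arcLength_zero, γ.arcLength_length] at h1
  exact h1.trans (lintegral_mono_set Ioc_subset_Icc_self)

end Curves

section Discretization

variable {X : Type*} [MetricSpace X]

/-! ### Discretizations of doubling spaces -/

/-- Otherwise `z` could be added to `A`; maximality would make it a vertex at distance zero from
itself. -/
theorem IsDiscretization.exists_dist_lt {r : ℝ} {A : Set X} (hA : IsDiscretization r A) (hr : 0 < r)
    (z : X) : ∃ x : A, dist (x : X) z < r := by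
  by_contra! h
  have hs : IsSeparatedSet r (insert z A) := by
    rintro x (rfl | hx) y (rfl | hy) hxy
    · exact absurd rfl hxy
    · rw [dist_comm]
      exact h ⟨y, hy⟩
    · exact h ⟨x, hx⟩
    · exact hA.prop x hx y hy hxy
  have hz : z ∈ A := hA.2 hs (subset_insert z A) (mem_insert z A)
  have := h ⟨z, hz⟩
  rw [dist_self] at this
  linarith

theorem IsSeparatedSet.pairwise_disjoint_ball {r : ℝ} {A : Set X} (hA : IsSeparatedSet r A) :
    Pairwise (Function.onFun Disjoint fun x : A => Metric.ball (x : X) (r / 4)) := by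
  intro x y hxy
  have h := hA x x.2 y y.2 (Subtype.coe_injective.ne hxy)
  rcases le_or_gt r 0 with hr | hr
  · simp [Function.onFun, Metric.ball_eq_empty.2 (show r / 4 ≤ 0 by linarith)]
  · exact Metric.ball_disjoint_ball (by linarith)

variable [MeasurableSpace X]

theorem measure_ball_le_pow_mul {μ : Measure X} {CD : ℝ}
    (hD : ∀ (x : X) (r : ℝ), 0 < r →
      μ (Metric.ball x (2 * r)) ≤ ENNReal.ofReal CD * μ (Metric.ball x r))
    (n : ℕ) (x : X) {r R : ℝ} (hr : 0 < r) (hR : R ≤ 2 ^ n * r) :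
    μ (Metric.ball x R) ≤ ENNReal.ofReal CD ^ n * μ (Metric.ball x r) := by
  induction n generalizing R with
  | zero =>
    rw [pow_zero, one_mul] at hR ⊢
    exact measure_mono (Metric.ball_subset_ball hR)
  | succ n ih =>
    calc μ (Metric.ball x R) ≤ μ (Metric.ball x (2 * (2 ^ n * r))) :=
          measure_mono (Metric.ball_subset_ball (by rw [← mul_assoc, ← pow_succ']; exact hR))
      _ ≤ ENNReal.ofReal CD * μ (Metric.ball x (2 ^ n * r)) := hD x _ (by positivity)
      _ ≤ ENNReal.ofReal CD * (ENNReal.ofReal CD ^ n * μ (Metric.ball x r)) := by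
          gcongr
          exact ih le_rfl
      _ = _ := by rw [pow_succ', mul_assoc]

theorem IsDoubling.isLocallyFiniteMeasure {μ : Measure X} (hμ : IsDoubling μ) :
    IsLocallyFiniteMeasure μ :=
  ⟨fun x => ⟨Metric.ball x 1, Metric.ball_mem_nhds x one_pos, (hμ.1 x 1 one_pos).2⟩⟩

variable [BorelSpace X]

/-- A packing bound from disjointness of the small balls. Countability of `A` is not presupposed, so
it can be deduced from this. -/
theorem IsSeparatedSet.tsum_measure_ball_le {μ : Measure X} {r : ℝ} {A : Set X}
    (hA : IsSeparatedSet r A) {S : Set A} {U : Set X}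
    (hS : ∀ x ∈ S, Metric.ball (x : X) (r / 4) ⊆ U) :
    ∑' x : S, μ (Metric.ball ((x : A) : X) (r / 4)) ≤ μ U :=
  (tsum_meas_le_meas_iUnion_of_disjoint μ
    (As := fun x : S => Metric.ball ((x : A) : X) (r / 4)) (fun _ => Metric.isOpen_ball.measurableSet)
    fun _ _ hxy => hA.pairwise_disjoint_ball (Subtype.coe_injective.ne hxy)).trans
      (measure_mono (iUnion_subset fun x => hS x x.2))

/-- The number of points of a separated set in a ball is bounded by the doubling constant. -/
theorem IsSeparatedSet.encard_le {μ : Measure X} {CD : ℝ}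
    (hpos : ∀ (x : X) (r : ℝ), 0 < r → 0 < μ (Metric.ball x r) ∧ μ (Metric.ball x r) < ∞)
    (hD : ∀ (x : X) (r : ℝ), 0 < r →
      μ (Metric.ball x (2 * r)) ≤ ENNReal.ofReal CD * μ (Metric.ball x r))
    {r : ℝ} (hr : 0 < r) {A : Set X} (hA : IsSeparatedSet r A) (z : X) {R : ℝ} (hR : 0 < R) {n : ℕ}
    (hn : 2 * R + r / 4 ≤ 2 ^ n * (r / 4)) :
    (({x : A | dist (x : X) z < R}.encard : ℕ∞) : ℝ≥0∞) ≤ ENNReal.ofReal CD ^ n := by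
  set S := {x : A | dist (x : X) z < R}
  set m := μ (Metric.ball z (R + r / 4))
  obtain ⟨hm0, hm1⟩ := hpos z (R + r / 4) (by positivity)
  -- Since `B(z, R + r/4) ⊆ B(x, 2R + r/4)`, the mass `m` is at most `CD ^ n` times that of each
  -- small ball, while the small balls together have mass at most `m`.
  have h1 : ∑' _ : S, m ≤ ENNReal.ofReal CD ^ n * m := by
    calc ∑' _ : S, m
        ≤ ∑' x : S, ENNReal.ofReal CD ^ n * μ (Metric.ball ((x : A) : X) (r / 4)) := by
          refine ENNReal.tsum_le_tsum fun x => ?_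
          refine le_trans (measure_mono ?_)
            (measure_ball_le_pow_mul hD n _ (show 0 < r / 4 by positivity) hn)
          refine Metric.ball_subset_ball' ?_
          have := x.2.out
          rw [dist_comm]
          linarith
      _ = ENNReal.ofReal CD ^ n * ∑' x : S, μ (Metric.ball ((x : A) : X) (r / 4)) :=
          ENNReal.tsum_mul_left
      _ ≤ _ := by
          gcongr
          refine hA.tsum_measure_ball_le fun x hx => Metric.ball_subset_ball' ?_
          have := hx.out
          linarith
  rw [ENNReal.tsum_const] at h1
  exact (ENNReal.mul_le_mul_iff_left hm0.ne' hm1.ne).1 h1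

theorem IsSeparatedSet.finite_dist_lt {μ : Measure X} (hμ : IsDoubling μ)
    {r : ℝ} (hr : 0 < r) {A : Set X} (hA : IsSeparatedSet r A) (z : X) (R : ℝ) :
    {x : A | dist (x : X) z < R}.Finite := by
  obtain ⟨hpos, CD, -, hD⟩ := hμ
  obtain ⟨n, hn⟩ := pow_unbounded_of_one_lt ((2 * max R 1 + r / 4) / (r / 4)) one_lt_two
  rw [div_lt_iff₀ (by positivity)] at hn
  have h := hA.encard_le hpos hD hr z (R := max R 1) (by positivity) hn.le
  refine Set.Finite.subset (s := {x : A | dist (x : X) z < max R 1}) ?_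
    fun x hx => lt_of_lt_of_le hx.out (le_max_left _ _)
  rw [← Set.encard_lt_top_iff, ← ENat.toENNReal_lt_top]
  exact h.trans_lt (ENNReal.pow_lt_top ENNReal.ofReal_lt_top)

theorem IsSeparatedSet.countable {μ : Measure X} (hμ : IsDoubling μ)
    {r : ℝ} (hr : 0 < r) {A : Set X} (hA : IsSeparatedSet r A) : Countable A := by
  rcases isEmpty_or_nonempty X with hX | ⟨⟨z⟩⟩
  · infer_instance
  have : (univ : Set A) = ⋃ n : ℕ, {x : A | dist (x : X) z < n} := by
    refine (eq_univ_of_forall fun x => mem_iUnion.2 ?_).symm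
    exact exists_nat_gt (dist (x : X) z)
  rw [← Set.countable_univ_iff, this]
  exact countable_iUnion fun n => (hA.finite_dist_lt hμ hr z n).countable

/-- Vertices of discretizations have a uniformly bounded number of neighbors. -/
theorem IsDoubling.exists_card_neighbors_le {μ : Measure X} (hμ : IsDoubling μ) :
    ∃ N : ℕ, ∀ r : ℝ, 0 < r → ∀ A : Set X, IsSeparatedSet r A → ∀ (z : X) (T : Finset A),
      (∀ x ∈ T, dist (x : X) z ≤ 3 * r) → T.card ≤ N := by
  obtain ⟨hpos, CD, hCD, hD⟩ := hμ
  -- With `R = 4r`, `2R + r/4 = 33r/4 ≤ 2 ^ 6 * (r/4)`.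
  refine ⟨⌊CD ^ 6⌋₊, fun r hr A hA z T hT => ?_⟩
  have h := hA.encard_le hpos hD hr z (R := 4 * r) (n := 6) (by positivity) (by linarith)
  have hsub : (T : Set A) ⊆ {x : A | dist (x : X) z < 4 * r} := fun x hx => by
    have := hT x hx
    rw [mem_ofPred_eq]
    linarith
  have h1 : ((T.card : ℕ) : ℝ≥0∞) ≤ ENNReal.ofReal CD ^ 6 := by
    refine le_trans ?_ h
    have := Set.encard_le_encard hsub
    rw [Set.encard_coe_eq_coe_finsetCard] at this
    exact_mod_cast ENat.toENNReal_le.2 this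
  refine Nat.le_floor ?_
  rw [← ENNReal.ofReal_pow (by linarith), ← ENNReal.ofReal_natCast] at h1
  exact (ENNReal.ofReal_le_ofReal_iff (by positivity)).1 h1

theorem discreteMeasure_singleton (μ : Measure X) (r : ℝ) (A : Set X) (x : A) :
    discreteMeasure μ r A {x} = μ (Metric.ball (x : X) (r / 4)) := by
  rw [discreteMeasure, Measure.sum_apply _ (measurableSet_singleton x), tsum_eq_single x]
  · simp
  · intro y hy
    simp [hy]

theorem lintegral_discreteMeasure (μ : Measure X) (r : ℝ) (A : Set X) (F : A → ℝ≥0∞) :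
    ∫⁻ x, F x ∂discreteMeasure μ r A = ∑' x : A, F x * μ (Metric.ball (x : X) (r / 4)) := by
  simp_rw [discreteMeasure, lintegral_sum_measure, lintegral_smul_measure, lintegral_dirac,
    smul_eq_mul, mul_comm]

end Discretization

section Extension

variable {X : Type*} [MetricSpace X]

/-! ### The extension operator -/

/-- The weight at `z` of the vertex `y` in the extension operator. It vanishes unless `y` is within
`r / 4` of being a nearest vertex to `z`. -/
def extensionWeight (r : ℝ) (A : Set X) (y : A) (z : X) : ℝ :=
  max 0 (Metric.infDist z A + r / 4 - dist (y : X) z)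

/-- The extension of a function on the vertices to the space, by weighted averages. -/
def extension (r : ℝ) (A : Set X) (u : A → ℝ) (z : X) : ℝ :=
  (∑ᶠ y, extensionWeight r A y z * u y) / ∑ᶠ y, extensionWeight r A y z

theorem extensionWeight_nonneg (r : ℝ) (A : Set X) (y : A) (z : X) :
    0 ≤ extensionWeight r A y z := le_max_left _ _

/-- Both distances in the weight are `1`-Lipschitz, and truncation at zero does not increase the
constant. -/
theorem abs_extensionWeight_sub_le (r : ℝ) (A : Set X) (y : A) (p q : X) :
    |extensionWeight r A y p - extensionWeight r A y q| ≤ 2 * dist p q := by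
  refine (abs_max_sub_max_le_max _ _ _ _).trans ?_
  rw [sub_self, abs_zero]
  refine max_le (by positivity) ?_
  have h1 := Metric.infDist_le_infDist_add_dist (s := A) (x := p) (y := q)
  have h2 := Metric.infDist_le_infDist_add_dist (s := A) (x := q) (y := p)
  have h3 := dist_triangle (y : X) p q
  have h4 := dist_triangle (y : X) q p
  rw [dist_comm q p] at h2 h4
  rw [abs_le]
  constructor <;> linarith

variable {r : ℝ} {A : Set X}

theorem extensionWeight_eq_zero (hA : IsDiscretization r A) (hr : 0 < r) {y : A} {z : X}
    (h : 5 * r / 4 ≤ dist (y : X) z) : extensionWeight r A y z = 0 := by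
  obtain ⟨x, hx⟩ := hA.exists_dist_lt hr z
  have := Metric.infDist_le_dist_of_mem (x := z) x.2
  rw [dist_comm] at this
  exact max_eq_left (by linarith)

/-- A vertex within `r / 8` of realizing the infimum suffices, so a nearest vertex need not be
produced. -/
theorem exists_le_extensionWeight (hA : IsDiscretization r A) (hr : 0 < r) (z : X) :
    ∃ y : A, r / 8 ≤ extensionWeight r A y z := by
  obtain ⟨x, -⟩ := hA.exists_dist_lt hr z
  obtain ⟨y, hy, hyz⟩ := (Metric.infDist_lt_iff (s := A) (x := z) ⟨x, x.2⟩).1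
    (show Metric.infDist z A < Metric.infDist z A + r / 8 by linarith)
  rw [dist_comm] at hyz
  exact ⟨⟨y, hy⟩, le_trans (by linarith) (le_max_right _ _)⟩

section Finset

variable {T : Finset A} {z : X}

/-- `T` may be any finite set containing the possible contributors at `z`; this freedom lets two
points share one index set in `abs_extension_sub_le`. -/
theorem finsum_extensionWeight_mul (hA : IsDiscretization r A) (hr : 0 < r)
    (hT : ∀ y : A, dist (y : X) z < 5 * r / 4 → y ∈ T) (u : A → ℝ) :
    ∑ᶠ y, extensionWeight r A y z * u y = ∑ y ∈ T, extensionWeight r A y z * u y := by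
  refine finsum_eq_sum_of_support_subset _ fun y hy => hT y ?_
  by_contra! h
  exact hy (by simp [extensionWeight_eq_zero hA hr h])

theorem finsum_extensionWeight (hA : IsDiscretization r A) (hr : 0 < r)
    (hT : ∀ y : A, dist (y : X) z < 5 * r / 4 → y ∈ T) :
    ∑ᶠ y, extensionWeight r A y z = ∑ y ∈ T, extensionWeight r A y z := by
  simpa using finsum_extensionWeight_mul hA hr hT 1

theorem le_sum_extensionWeight (hA : IsDiscretization r A) (hr : 0 < r)
    (hT : ∀ y : A, dist (y : X) z < 5 * r / 4 → y ∈ T) :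
    r / 8 ≤ ∑ y ∈ T, extensionWeight r A y z := by
  obtain ⟨y, hy⟩ := exists_le_extensionWeight hA hr z
  have hyT : y ∈ T := by
    refine hT y ?_
    by_contra! h
    rw [extensionWeight_eq_zero hA hr h] at hy
    linarith
  exact hy.trans (Finset.single_le_sum (fun y _ => extensionWeight_nonneg r A y z) hyT)

theorem extension_eq (hA : IsDiscretization r A) (hr : 0 < r)
    (hT : ∀ y : A, dist (y : X) z < 5 * r / 4 → y ∈ T) (u : A → ℝ) :
    extension r A u z =
      (∑ y ∈ T, extensionWeight r A y z * u y) / ∑ y ∈ T, extensionWeight r A y z := by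
  rw [extension, finsum_extensionWeight_mul hA hr hT, finsum_extensionWeight hA hr hT]

/-- The normalized weights sum to one, so constants are reproduced. -/
theorem extension_sub_const (hA : IsDiscretization r A) (hr : 0 < r)
    (hT : ∀ y : A, dist (y : X) z < 5 * r / 4 → y ∈ T) (u : A → ℝ) (c : ℝ) :
    extension r A u z - c = extension r A (fun y => u y - c) z := by
  have hW := le_sum_extensionWeight hA hr hT
  rw [extension_eq hA hr hT, extension_eq hA hr hT, eq_div_iff (by linarith), sub_mul,
    div_mul_cancel₀ _ (by linarith), Finset.mul_sum, ← Finset.sum_sub_distrib]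
  exact Finset.sum_congr rfl fun y _ => by ring

/-- Maximum principle: the extension is a convex combination of the values on `T`. -/
theorem abs_extension_le (hA : IsDiscretization r A) (hr : 0 < r)
    (hT : ∀ y : A, dist (y : X) z < 5 * r / 4 → y ∈ T) {u : A → ℝ} {M : ℝ}
    (hu : ∀ y ∈ T, |u y| ≤ M) : |extension r A u z| ≤ M := by
  have hW := le_sum_extensionWeight hA hr hT
  rw [extension_eq hA hr hT, abs_div,
    abs_of_pos (a := ∑ y ∈ T, extensionWeight r A y z) (by linarith),
    div_le_iff₀ (by linarith), Finset.mul_sum]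
  refine (Finset.abs_sum_le_sum_abs _ _).trans (Finset.sum_le_sum fun y hy => ?_)
  rw [abs_mul, abs_of_nonneg (extensionWeight_nonneg r A y z), mul_comm]
  exact mul_le_mul_of_nonneg_right (hu y hy) (extensionWeight_nonneg r A y z)

end Finset

/-- The extension of `u` takes the value `u x` near the vertex `x`. -/
theorem extension_eq_of_mem_ball (hA : IsDiscretization r A) (hr : 0 < r) (u : A → ℝ) (x : A)
    {z : X} (hz : z ∈ Metric.ball (x : X) (r / 4)) : extension r A u z = u x := by
  rw [Metric.mem_ball, dist_comm] at hz
  -- Here `dist y z > 3r/4`, whereas the nearest-vertex distance plus `r / 4` is below `r / 2`.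
  have h0 : ∀ y : A, y ≠ x → extensionWeight r A y z = 0 := fun y hy => by
    have h1 := hA.prop y y.2 x x.2 (Subtype.coe_injective.ne hy)
    have h2 := dist_triangle (y : X) z x
    have h3 := Metric.infDist_le_dist_of_mem (x := z) x.2
    rw [dist_comm z] at h2 h3
    exact max_eq_left (by linarith)
  obtain ⟨y, hy⟩ := exists_le_extensionWeight hA hr z
  have hyx : y = x := by
    by_contra h
    rw [h0 y h] at hy
    linarith
  rw [hyx] at hy
  rw [extension, finsum_eq_single _ x h0, finsum_eq_single _ x fun y hy => by rw [h0 y hy, zero_mul],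
    mul_div_cancel_left₀ _ (by linarith)]

/-- A vertex where `u` is nonzero lies near each point where the extension of `u` is nonzero. -/
theorem exists_of_extension_ne_zero (hA : IsDiscretization r A) (hr : 0 < r) {u : A → ℝ} {z : X}
    (hz : extension r A u z ≠ 0) : ∃ x : A, u x ≠ 0 ∧ dist (x : X) z < 5 * r / 4 := by
  by_contra! h
  refine hz ?_
  have : ∀ y, extensionWeight r A y z * u y = 0 := fun y => by
    by_cases hy : u y = 0
    · rw [hy, mul_zero]
    · rw [extensionWeight_eq_zero hA hr (h y hy), zero_mul]
  simp [extension, this]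

/-- Near a vertex, the Lipschitz constant of the extension is controlled by the differences along
the edges at this vertex. -/
theorem abs_extension_sub_le (hA : IsDiscretization r A) (hr : 0 < r) {T : Finset A} (x : A)
    (hT : ∀ y : A, dist (y : X) x ≤ 3 * r → y ∈ T) (u : A → ℝ) {p q : X}
    (hp : p ∈ Metric.ball (x : X) (3 * r / 2)) (hq : q ∈ Metric.ball (x : X) (3 * r / 2)) :
    |extension r A u p - extension r A u q| ≤
      16 * (1 + T.card) / r * (∑ y ∈ T, |u y - u x|) * dist p q := by
  -- The constant is `16 = 2 * 8`: weights are `2`-Lipschitz and the denominator is at least `r /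
  -- 8`.
  have hfinal : ∀ c e d W : ℝ, 0 ≤ c → 0 ≤ e → 0 ≤ d → r / 8 ≤ W →
      2 * (1 + c) * e * d ≤ 16 * (1 + c) / r * e * d * W := fun c e d W hc he hd hW => by
    refine le_trans (le_of_eq ?_) (mul_le_mul_of_nonneg_left hW (by positivity))
    field_simp
    ring
  -- `5r/4 + 3r/2 = 11r/4 < 3r`, so every contributor at a point of the ball is `x` or a neighbor of
  -- `x`.
  have hT' : ∀ z ∈ Metric.ball (x : X) (3 * r / 2), ∀ y : A, dist (y : X) z < 5 * r / 4 → y ∈ T :=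
    fun z hz y hy => hT y (by
      rw [Metric.mem_ball] at hz
      linarith [dist_triangle (y : X) z x])
  rw [← sub_sub_sub_cancel_right _ _ (u x), extension_sub_const hA hr (hT' p hp),
    extension_sub_const hA hr (hT' q hq)]
  set v : A → ℝ := fun y => u y - u x
  set e := ∑ y ∈ T, |v y|
  have hve : ∀ y ∈ T, |v y| ≤ e := fun y hy =>
    Finset.single_le_sum (f := fun y => |v y|) (fun y _ => abs_nonneg _) hy
  have he : 0 ≤ e := Finset.sum_nonneg fun y _ => abs_nonneg _
  have hWp := le_sum_extensionWeight hA hr (hT' p hp)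
  have hWq := le_sum_extensionWeight hA hr (hT' q hq)
  have hQ := abs_extension_le hA hr (hT' q hq) hve
  have hQ' := extension_eq hA hr (hT' q hq) v
  rw [extension_eq hA hr (hT' p hp)]
  set Wp := ∑ y ∈ T, extensionWeight r A y p
  set Wq := ∑ y ∈ T, extensionWeight r A y q
  set Np := ∑ y ∈ T, extensionWeight r A y p * v y
  set Nq := ∑ y ∈ T, extensionWeight r A y q * v y
  set Q := extension r A v q
  have hNq : Nq = Q * Wq := by rw [hQ', div_mul_cancel₀ _ (by linarith)]
  have hN : |Np - Nq| ≤ 2 * dist p q * e := by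
    rw [← Finset.sum_sub_distrib, Finset.mul_sum]
    refine (Finset.abs_sum_le_sum_abs _ _).trans (Finset.sum_le_sum fun y _ => ?_)
    rw [← sub_mul, abs_mul]
    exact mul_le_mul_of_nonneg_right (abs_extensionWeight_sub_le r A y p q) (abs_nonneg _)
  have hW : |Wq - Wp| ≤ T.card * (2 * dist p q) := by
    rw [← Finset.sum_sub_distrib, ← nsmul_eq_mul, ← Finset.sum_const]
    refine (Finset.abs_sum_le_sum_abs _ _).trans (Finset.sum_le_sum fun y _ => ?_)
    rw [dist_comm]
    exact abs_extensionWeight_sub_le r A y q p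
  -- Quotient rule arranged so that only `Wp` remains as a denominator and `Q` is bounded by the
  -- maximum principle.
  have hdiff : Np / Wp - Q = ((Np - Nq) + Q * (Wq - Wp)) / Wp := by
    rw [eq_div_iff (by linarith), sub_mul, div_mul_cancel₀ _ (by linarith), hNq]
    ring
  have hnum : |(Np - Nq) + Q * (Wq - Wp)| ≤ 2 * (1 + T.card) * e * dist p q := by
    refine (abs_add_le _ _).trans ?_
    rw [abs_mul]
    have := mul_le_mul hQ hW (abs_nonneg _) he
    linarith
  rw [hdiff, abs_div, abs_of_pos (a := Wp) (by linarith), div_le_iff₀ (by linarith)]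
  exact hnum.trans (hfinal _ _ _ _ T.card.cast_nonneg he dist_nonneg hWp)

end Extension

section Energy

/-! ### Energy estimates -/

theorem ofReal_abs_rpow_two (a : ℝ) : ENNReal.ofReal |a| ^ (2 : ℝ) = ENNReal.ofReal (a ^ 2) := by
  rw [ENNReal.rpow_two, ← ENNReal.ofReal_pow (abs_nonneg a), sq_abs]

variable {X : Type*} [MetricSpace X] {r : ℝ} {A : Set X}

/-- `T` may contain `x`, which is not its own neighbor; its term vanishes. -/
theorem sum_le_tsum_neighborSet (x : A) (u : A → ℝ) {T : Finset A}
    (hT : ∀ y ∈ T, dist (y : X) x ≤ 3 * r) :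
    ∑ y ∈ T, ENNReal.ofReal (|u y - u x| ^ 2 / r ^ 2) ≤
      ∑' y : (proximityGraph r A).neighborSet x, ENNReal.ofReal (|u y - u x| ^ 2 / r ^ 2) := by
  classical
  rw [tsum_subtype ((proximityGraph r A).neighborSet x)
    fun y => ENNReal.ofReal (|u y - u x| ^ 2 / r ^ 2)]
  refine le_trans (Finset.sum_le_sum fun y hy => ?_) (ENNReal.sum_le_tsum T)
  by_cases hyx : y = x
  · simp [hyx]
  · have : y ∈ (proximityGraph r A).neighborSet x :=
      ⟨Ne.symm hyx, by rw [dist_comm]; exact hT y hy⟩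
    rw [indicator_of_mem this]

variable [MeasurableSpace X] {μ : Measure X}

theorem modulus_empty (p : ℝ) (hp : 0 < p) (μ : Measure X) : modulus p μ ∅ = 0 := by
  refine le_antisymm ((iInf₂_le (fun _ => 0) ⟨measurable_const, by simp⟩).trans ?_) zero_le
  simp [ENNReal.zero_rpow_of_pos hp]

theorem IsUpperGradient.isWeakUpperGradient {p : ℝ} (hp : 0 < p) {f : X → ℝ} {g : X → ℝ≥0∞}
    (hg : IsUpperGradient f g) (μ : Measure X) : IsWeakUpperGradient p μ f g :=
  ⟨hg.1, ∅, modulus_empty p hp μ, fun γ _ => hg.2 γ⟩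

/-- Minimality compares only with competitors in `L^p`; for any other `h` the right-hand side is
infinite. -/
theorem IsMinimalWeakUpperGradient.lintegral_le {p : ℝ} (hp : 0 < p) {f : X → ℝ} {g h : X → ℝ≥0∞}
    (hg : IsMinimalWeakUpperGradient p μ f g) (hh : IsUpperGradient f h) :
    ∫⁻ x, g x ^ p ∂μ ≤ ∫⁻ x, h x ^ p ∂μ := by
  rcases eq_or_ne (∫⁻ x, h x ^ p ∂μ) ∞ with htop | htop
  · rw [htop]
    exact le_top
  · refine lintegral_mono_ae ?_
    filter_upwards [hg.2.2 h (hh.isWeakUpperGradient hp μ) htop.lt_top] with x hx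
    gcongr

theorem capacity_empty (p : ℝ) (hp : 0 < p) (μ : Measure X) : capacity p μ ∅ = 0 := by
  refine le_antisymm ((iInf₂_le (fun _ => 0) ⟨aemeasurable_const, by simp⟩).trans ?_) zero_le
  have h : upperGradientEnergy p μ (fun _ : X => 0) ≤ 0 := by
    have h0 : IsUpperGradient (fun _ : X => (0 : ℝ)) fun _ => 0 :=
      ⟨measurable_const, fun γ => by simp [UpperGradientIneq]⟩
    refine (iInf₂_le _ h0).trans ?_
    simp [ENNReal.zero_rpow_of_pos hp]
  simpa [ENNReal.zero_rpow_of_pos hp] using h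

variable [BorelSpace X]

theorem continuous_extension (hμ : IsDoubling μ) (hr : 0 < r) (hA : IsDiscretization r A)
    (u : A → ℝ) : Continuous (extension r A u) := by
  refine continuous_iff_continuousAt.2 fun z => ?_
  obtain ⟨x, hx⟩ := hA.exists_dist_lt hr z
  have hfin := IsSeparatedSet.finite_dist_lt hμ hr hA.prop (x : X) (4 * r)
  have hL := LipschitzOnWith.of_dist_le' (f := extension r A u)
    (s := Metric.ball (x : X) (3 * r / 2))
    (fun p hp q hq => abs_extension_sub_le hA hr (T := hfin.toFinset) x
      (fun y hy => hfin.mem_toFinset.2 (show dist (y : X) x < 4 * r by linarith)) u hp hq)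
  refine hL.continuousOn.continuousAt (Metric.isOpen_ball.mem_nhds ?_)
  rw [Metric.mem_ball, dist_comm]
  linarith

/-- The extension operator is bounded from the graph energy to the upper gradient energy. -/
theorem IsDoubling.exists_upperGradient_extension (hμ : IsDoubling μ) :
    ∃ C : ℝ, 1 ≤ C ∧ ∀ r : ℝ, 0 < r → ∀ A : Set X, IsDiscretization r A → ∀ u : A → ℝ,
      ∃ g : X → ℝ≥0∞, IsUpperGradient (extension r A u) g ∧
        ∫⁻ x, g x ^ (2 : ℝ) ∂μ ≤ ENNReal.ofReal C * graphEnergy μ r A u := by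
  obtain ⟨N, hN⟩ := hμ.exists_card_neighbors_le
  obtain ⟨CD, hCD, hD⟩ := hμ.2
  -- `16 * (1 + N)` comes from the Lipschitz estimate and the last `N` from Cauchy–Schwarz; the
  -- later factor `CD ^ 3` reflects `3r/2 ≤ 2 ^ 3 * (r/4)`.
  set K : ℝ := (16 * (1 + N)) ^ 2 * N
  have hK : 0 ≤ K := by positivity
  refine ⟨max 1 (K * CD ^ 3), le_max_left _ _, fun r hr A hA u => ?_⟩
  have : Countable A := IsSeparatedSet.countable hμ hr hA.prop
  have hfin : ∀ x : A, {y : A | dist (y : X) x ≤ 3 * r}.Finite := fun x =>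
    (IsSeparatedSet.finite_dist_lt hμ hr hA.prop (x : X) (4 * r)).subset fun y hy =>
      show dist (y : X) x < 4 * r from lt_of_le_of_lt hy (by linarith)
  let T : A → Finset A := fun x => (hfin x).toFinset
  have hT : ∀ x y : A, y ∈ T x ↔ dist (y : X) x ≤ 3 * r := fun x y => (hfin x).mem_toFinset
  have hTN : ∀ x, (T x).card ≤ N := fun x => hN r hr A hA.prop x (T x) fun y hy => (hT x y).1 hy
  let c : A → ℝ := fun x => 16 * (1 + N) / r * ∑ y ∈ T x, |u y - u x|
  have hc : ∀ x, 0 ≤ c x := fun x =>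
    mul_nonneg (by positivity) (Finset.sum_nonneg fun y _ => abs_nonneg _)
  let G : A → X → ℝ≥0∞ := fun x =>
    (Metric.ball (x : X) (3 * r / 2)).indicator fun _ => ENNReal.ofReal (c x ^ 2)
  have hG : ∀ x, Measurable (G x) := fun x =>
    measurable_const.indicator Metric.isOpen_ball.measurableSet
  -- The `ℓ²` combination dominates each `c x` on its ball, and its square integrates term by term
  -- without counting overlaps. The radius `r / 2` works because a vertex `x` within `r` of `z`
  -- gives `B(z, r/2) ⊆ B(x, 3r/2)`.
  refine ⟨fun z => (∑' x, G x z) ^ (1 / 2 : ℝ),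
    ⟨(Measurable.tsum hG).pow_const _, upperGradientIneq_of_lipschitz_on_balls
      (half_pos hr) fun z => ?_⟩, ?_⟩
  · obtain ⟨x, hx⟩ := hA.exists_dist_lt hr z
    rw [dist_comm] at hx
    refine ⟨c x, hc x, fun p hp => ?_⟩
    have hp' : p ∈ Metric.ball (x : X) (3 * r / 2) := by
      rw [Metric.mem_ball] at hp ⊢
      linarith [dist_triangle p z x]
    have hz' : z ∈ Metric.ball (x : X) (3 * r / 2) := by
      rw [Metric.mem_ball]
      linarith
    constructor
    · calc ENNReal.ofReal (c x) = (ENNReal.ofReal (c x ^ 2)) ^ (1 / 2 : ℝ) := by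
            rw [ENNReal.ofReal_rpow_of_nonneg (by positivity) (by norm_num), ← Real.sqrt_eq_rpow,
              Real.sqrt_sq (hc x)]
        _ ≤ (∑' x, G x p) ^ (1 / 2 : ℝ) := by
            gcongr
            refine le_trans (le_of_eq ?_) (ENNReal.le_tsum x)
            exact (indicator_of_mem hp' fun _ => ENNReal.ofReal (c x ^ 2)).symm
    · refine (abs_extension_sub_le hA hr x (fun y hy => (hT x y).2 hy) u hp' hz').trans ?_
      have h1 : (16 * (1 + ((T x).card : ℝ)) / r) ≤ 16 * (1 + N) / r := by
        gcongr
        exact hTN x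
      exact mul_le_mul_of_nonneg_right (mul_le_mul_of_nonneg_right h1
        (Finset.sum_nonneg fun y _ => abs_nonneg _)) dist_nonneg
  · have hsq : ∀ z, ((∑' x, G x z) ^ (1 / 2 : ℝ)) ^ (2 : ℝ) = ∑' x, G x z := fun z => by
      rw [← ENNReal.rpow_mul]
      norm_num
    simp_rw [hsq]
    rw [lintegral_tsum fun x => (hG x).aemeasurable, graphEnergy, ← ENNReal.tsum_mul_left]
    refine ENNReal.tsum_le_tsum fun x => ?_
    have h1 : ENNReal.ofReal (c x ^ 2) ≤ ENNReal.ofReal K *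
        ∑' y : (proximityGraph r A).neighborSet x, ENNReal.ofReal (|u y - u x| ^ 2 / r ^ 2) := by
      refine le_trans ?_ (mul_le_mul_right (sum_le_tsum_neighborSet x u
        (T := T x) fun y hy => (hT x y).1 hy) _)
      rw [← ENNReal.ofReal_sum_of_nonneg fun y _ => by positivity, ← ENNReal.ofReal_mul hK,
        ← Finset.sum_div]
      refine ENNReal.ofReal_le_ofReal ?_
      have h2 := sq_sum_le_card_mul_sum_sq (s := T x) (f := fun y => |u y - u x|)
      have h3 : (∑ y ∈ T x, |u y - u x|) ^ 2 ≤ N * ∑ y ∈ T x, |u y - u x| ^ 2 :=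
        h2.trans (mul_le_mul_of_nonneg_right (by exact_mod_cast hTN x)
          (Finset.sum_nonneg fun y _ => by positivity))
      calc c x ^ 2 = (16 * (1 + N)) ^ 2 / r ^ 2 * (∑ y ∈ T x, |u y - u x|) ^ 2 := by
            rw [mul_pow, div_pow]
        _ ≤ (16 * (1 + N)) ^ 2 / r ^ 2 * (N * ∑ y ∈ T x, |u y - u x| ^ 2) := by gcongr
        _ = _ := by ring
    rw [lintegral_indicator Metric.isOpen_ball.measurableSet, setLIntegral_const,
      discreteMeasure_singleton, ENNReal.tsum_mul_right]
    calc ENNReal.ofReal (c x ^ 2) * μ (Metric.ball (x : X) (3 * r / 2))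
        ≤ (ENNReal.ofReal K * ∑' y : (proximityGraph r A).neighborSet x,
            ENNReal.ofReal (|u y - u x| ^ 2 / r ^ 2)) *
            (ENNReal.ofReal CD ^ 3 * μ (Metric.ball (x : X) (r / 4))) := by
          gcongr
          exact measure_ball_le_pow_mul hD 3 _ (by positivity) (by linarith)
      _ = ENNReal.ofReal (K * CD ^ 3) * ((∑' y : (proximityGraph r A).neighborSet x,
            ENNReal.ofReal (|u y - u x| ^ 2 / r ^ 2)) * μ (Metric.ball (x : X) (r / 4))) := by
          rw [ENNReal.ofReal_mul hK, ENNReal.ofReal_pow (by linarith)]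
          ring
      _ ≤ _ := by
          gcongr
          exact le_max_right _ _

/-- The graph energy is controlled by the `L²` norm. -/
theorem graphEnergy_lt_top (hμ : IsDoubling μ) (hr : 0 < r) (hA : IsSeparatedSet r A) {u : A → ℝ}
    (hu : ∑' x : A, ENNReal.ofReal (u x ^ 2) * μ (Metric.ball (x : X) (r / 4)) < ∞) :
    graphEnergy μ r A u < ∞ := by
  obtain ⟨CD, -, hD⟩ := hμ.2
  set D := ENNReal.ofReal CD ^ 4
  have hDtop : D < ∞ := ENNReal.pow_lt_top ENNReal.ofReal_lt_top
  set U : A → ℝ≥0∞ := fun x => ENNReal.ofReal (u x ^ 2)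
  set m : A → ℝ≥0∞ := fun x => μ (Metric.ball (x : X) (r / 4))
  have hball : ∀ x : A, ∀ y ∈ (proximityGraph r A).neighborSet x,
      Metric.ball (y : X) (r / 4) ⊆ Metric.ball (x : X) (4 * r) := fun x y hy => by
    refine Metric.ball_subset_ball' ?_
    have := hy.2
    rw [dist_comm]
    linarith
  have h4 : ∀ x : A, μ (Metric.ball (x : X) (4 * r)) ≤ D * m x := fun x =>
    measure_ball_le_pow_mul hD 4 _ (by positivity) (by linarith)
  have hsum : ∀ x : A, ∑' y : (proximityGraph r A).neighborSet x, m y ≤ D * m x := fun x =>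
    (hA.tsum_measure_ball_le (hball x)).trans (h4 x)
  have hm : ∀ x : A, ∀ y ∈ (proximityGraph r A).neighborSet x, m x ≤ D * m y := fun x y hy =>
    (measure_mono (hball y x (SimpleGraph.Adj.symm (G := proximityGraph r A) hy))).trans (h4 y)
  set k := ENNReal.ofReal (2 / r ^ 2)
  have hterm : ∀ x y : A, ENNReal.ofReal (|u y - u x| ^ 2 / r ^ 2) ≤ k * (U y + U x) :=
      fun x y => by
    rw [← ENNReal.ofReal_add (by positivity) (by positivity),
      ← ENNReal.ofReal_mul (by positivity), div_mul_eq_mul_div]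
    refine ENNReal.ofReal_le_ofReal ?_
    gcongr
    rw [sq_abs]
    nlinarith [sq_nonneg (u y + u x)]
  -- Symmetry of adjacency moves the neighbor sum onto the masses `m y`, which packing bounds by `D
  -- * m x`.
  have hswap : ∑' x : A, ∑' y : (proximityGraph r A).neighborSet x, U y * m x =
      ∑' x : A, ∑' y : (proximityGraph r A).neighborSet x, U x * m y := by
    have e1 : ∀ x : A, ∑' y : (proximityGraph r A).neighborSet x, U y * m x =
        ∑' y : A, ((proximityGraph r A).neighborSet x).indicator (fun y => U y * m x) y :=
      fun x => tsum_subtype ((proximityGraph r A).neighborSet x) fun y => U y * m x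
    have e2 : ∀ x : A, ∑' y : (proximityGraph r A).neighborSet x, U x * m y =
        ∑' y : A, ((proximityGraph r A).neighborSet x).indicator (fun y => U x * m y) y :=
      fun x => tsum_subtype ((proximityGraph r A).neighborSet x) fun y => U x * m y
    simp_rw [e1, e2]
    rw [ENNReal.tsum_comm]
    refine tsum_congr fun x => tsum_congr fun y => ?_
    by_cases h : (proximityGraph r A).Adj x y
    · rw [indicator_of_mem (show x ∈ (proximityGraph r A).neighborSet y from h.symm),
        indicator_of_mem (show y ∈ (proximityGraph r A).neighborSet x from h)]
    · rw [indicator_of_notMem (show x ∉ (proximityGraph r A).neighborSet y from fun h' => h h'.symm),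
        indicator_of_notMem (show y ∉ (proximityGraph r A).neighborSet x from h)]
  have hbound : ∑' x : A, ∑' y : (proximityGraph r A).neighborSet x, U x * m y ≤
      D * ∑' x : A, U x * m x := by
    rw [← ENNReal.tsum_mul_left]
    refine ENNReal.tsum_le_tsum fun x => ?_
    rw [ENNReal.tsum_mul_left, mul_left_comm]
    gcongr
    exact hsum x
  -- Comparability of neighboring masses reduces this sum to the previous one, replacing a neighbor
  -- count.
  have hbound' : ∑' x : A, ∑' y : (proximityGraph r A).neighborSet x, U x * m x ≤
      D * ∑' x : A, ∑' y : (proximityGraph r A).neighborSet x, U x * m y := by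
    simp_rw [← ENNReal.tsum_mul_left]
    refine ENNReal.tsum_le_tsum fun x => ENNReal.tsum_le_tsum fun y => ?_
    rw [mul_left_comm]
    gcongr
    exact hm x y y.2
  have hE : graphEnergy μ r A u ≤ k * (D * ∑' x : A, U x * m x +
      D * (D * ∑' x : A, U x * m x)) := by
    calc graphEnergy μ r A u
        ≤ ∑' x : A, ∑' y : (proximityGraph r A).neighborSet x, k * (U y * m x + U x * m x) := by
          refine ENNReal.tsum_le_tsum fun x => ENNReal.tsum_le_tsum fun y => ?_
          rw [discreteMeasure_singleton, ← add_mul, ← mul_assoc]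
          gcongr
          exact hterm x y
      _ = k * (∑' x : A, ∑' y : (proximityGraph r A).neighborSet x, U y * m x +
            ∑' x : A, ∑' y : (proximityGraph r A).neighborSet x, U x * m x) := by
          simp_rw [ENNReal.tsum_mul_left, ENNReal.tsum_add, ENNReal.tsum_mul_left]
      _ ≤ _ := by
          rw [hswap]
          gcongr
          exact hbound'.trans (mul_le_mul_right hbound _)
  refine hE.trans_lt ?_
  have hDu := ENNReal.mul_lt_top hDtop hu
  exact ENNReal.mul_lt_top ENNReal.ofReal_lt_top
    (ENNReal.add_lt_top.2 ⟨hDu, ENNReal.mul_lt_top hDtop hDu⟩)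

theorem lintegral_extension_lt_top (hμ : IsDoubling μ) (hr : 0 < r) (hA : IsDiscretization r A)
    {u : A → ℝ} (hu : ∑' x : A, ENNReal.ofReal (u x ^ 2) * μ (Metric.ball (x : X) (r / 4)) < ∞) :
    ∫⁻ z, ENNReal.ofReal |extension r A u z| ^ (2 : ℝ) ∂μ < ∞ := by
  have : Countable A := IsSeparatedSet.countable hμ hr hA.prop
  obtain ⟨CD, -, hD⟩ := hμ.2
  let G : A → X → ℝ≥0∞ := fun x =>
    (Metric.ball (x : X) (5 * r / 4)).indicator fun _ => ENNReal.ofReal (u x ^ 2)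
  have hpt : ∀ z, ENNReal.ofReal |extension r A u z| ^ (2 : ℝ) ≤ ∑' x, G x z := fun z => by
    have hfin := IsSeparatedSet.finite_dist_lt hμ hr hA.prop z (5 * r / 4)
    set T := hfin.toFinset
    have hT : ∀ y : A, y ∈ T ↔ dist (y : X) z < 5 * r / 4 := fun y => hfin.mem_toFinset
    -- Using the `ℓ²` norm of the nearby values as the bound in the maximum principle avoids a
    -- cardinality factor.
    have h1 : |extension r A u z| ≤ √(∑ y ∈ T, u y ^ 2) :=
      abs_extension_le hA hr (fun y hy => (hT y).2 hy) fun y hy =>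
        Real.abs_le_sqrt (Finset.single_le_sum (f := fun y => u y ^ 2)
          (fun y _ => sq_nonneg _) hy)
    rw [ofReal_abs_rpow_two]
    calc ENNReal.ofReal (extension r A u z ^ 2) ≤ ENNReal.ofReal (∑ y ∈ T, u y ^ 2) := by
          refine ENNReal.ofReal_le_ofReal ?_
          rw [← sq_abs, ← Real.sq_sqrt (Finset.sum_nonneg fun y (_ : y ∈ T) => sq_nonneg (u y))]
          gcongr
      _ = ∑ y ∈ T, G y z := by
          rw [ENNReal.ofReal_sum_of_nonneg fun y _ => sq_nonneg _]
          refine Finset.sum_congr rfl fun y hy =>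
            (indicator_of_mem ?_ fun _ => ENNReal.ofReal (u y ^ 2)).symm
          rw [Metric.mem_ball, dist_comm]
          exact (hT y).1 hy
      _ ≤ _ := ENNReal.sum_le_tsum T
  calc ∫⁻ z, ENNReal.ofReal |extension r A u z| ^ (2 : ℝ) ∂μ
      ≤ ∫⁻ z, ∑' x, G x z ∂μ := lintegral_mono hpt
    _ = ∑' x : A, ENNReal.ofReal (u x ^ 2) * μ (Metric.ball (x : X) (5 * r / 4)) := by
        rw [lintegral_tsum fun x =>
          (measurable_const.indicator Metric.isOpen_ball.measurableSet).aemeasurable]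
        refine tsum_congr fun x => ?_
        rw [lintegral_indicator Metric.isOpen_ball.measurableSet, setLIntegral_const]
    _ ≤ ∑' x : A, ENNReal.ofReal CD ^ 3 *
          (ENNReal.ofReal (u x ^ 2) * μ (Metric.ball (x : X) (r / 4))) := by
        refine ENNReal.tsum_le_tsum fun x => ?_
        rw [mul_left_comm]
        gcongr
        exact measure_ball_le_pow_mul hD 3 _ (by positivity) (by linarith)
    _ < ∞ := by
        rw [ENNReal.tsum_mul_left]
        exact ENNReal.mul_lt_top (ENNReal.pow_lt_top ENNReal.ofReal_lt_top) hu

/-- The extension operator maps square summable functions to Newton-Sobolev functions. -/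
theorem memNewtonSobolev_extension (hμ : IsDoubling μ) (hr : 0 < r) (hA : IsDiscretization r A)
    {u : A → ℝ} (hu : ∑' x : A, ENNReal.ofReal (u x ^ 2) * μ (Metric.ball (x : X) (r / 4)) < ∞) :
    MemNewtonSobolev 2 μ (extension r A u) := by
  refine ⟨(continuous_extension hμ hr hA u).aemeasurable, ENNReal.add_lt_top.2 ⟨?_, ?_⟩⟩
  · exact ENNReal.rpow_lt_top_of_nonneg (by norm_num) (lintegral_extension_lt_top hμ hr hA hu).ne
  · obtain ⟨C, -, hC⟩ := hμ.exists_upperGradient_extension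
    obtain ⟨g, hg, hgE⟩ := hC r hr A hA u
    refine (iInf₂_le g hg).trans_lt (ENNReal.rpow_lt_top_of_nonneg (by norm_num) ?_)
    exact (hgE.trans_lt (ENNReal.mul_lt_top ENNReal.ofReal_lt_top
      (graphEnergy_lt_top hμ hr hA.prop hu))).ne

/-- A function on the vertices that vanishes outside the discretization of a bounded set extends to a
Newton-Sobolev function with zero boundary values. -/
theorem memNewtonSobolevZero_extension (hμ : IsDoubling μ) (hr : 0 < r) (hA : IsDiscretization r A)
    {Ω : Set X} (hΩ : Bornology.IsBounded Ω) {u : A → ℝ} (hu : MemDiscreteZero r A Ω u) :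
    MemNewtonSobolevZero 2 μ Ω (extension r A u) := by
  have hsub : ∀ x : A, u x ≠ 0 → Metric.ball (x : X) (20 * r) ⊆ Ω := fun x hx => by
    by_contra h
    exact hx (hu x h)
  -- Vertices carrying nonzero values lie in the bounded set `Ω`, so there are finitely many and `u`
  -- is square summable.
  have hfin : {x : A | u x ≠ 0}.Finite := by
    rcases Set.eq_empty_or_nonempty {x : A | u x ≠ 0} with h | ⟨x₀, -⟩
    · rw [h]
      exact finite_empty
    obtain ⟨R, hR⟩ := hΩ.subset_ball (x₀ : X)
    exact (IsSeparatedSet.finite_dist_lt hμ hr hA.prop (x₀ : X) R).subset fun x hx =>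
      hR (hsub x hx (Metric.mem_ball_self (by positivity)))
  refine ⟨memNewtonSobolev_extension hμ hr hA ?_, ?_⟩
  · rw [tsum_eq_sum (s := hfin.toFinset)]
    · exact ENNReal.sum_lt_top.2 fun x _ => ENNReal.mul_lt_top ENNReal.ofReal_lt_top
        (hμ.1 x (r / 4) (by positivity)).2
    · intro x hx
      have : u x = 0 := by
        by_contra h
        exact hx (hfin.mem_toFinset.2 h)
      simp [this]
  · have : {z | z ∉ Ω ∧ extension r A u z ≠ 0} = ∅ := by
      refine Set.eq_empty_of_forall_notMem fun z hz => hz.1 ?_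
      obtain ⟨x, hx, hxz⟩ := exists_of_extension_ne_zero hA hr hz.2
      refine hsub x hx ?_
      rw [Metric.mem_ball, dist_comm]
      linarith
    rw [this]
    exact capacity_empty 2 two_pos μ

theorem ballAverage_extension (hμ : IsDoubling μ) (hr : 0 < r) (hA : IsDiscretization r A)
    (u : A → ℝ) (x : A) : ballAverage μ r A (extension r A u) x = u x := by
  obtain ⟨h0, h1⟩ := hμ.1 x (r / 4) (by positivity)
  rw [ballAverage, setAverage_congr_fun Metric.isOpen_ball.measurableSet
    (Eventually.of_forall fun z hz => extension_eq_of_mem_ball hA hr u x hz)]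
  exact setAverage_const h0.ne' h1.ne _

theorem tsum_lt_top_of_memLp {u : A → ℝ} (hu : MemLp u 2 (discreteMeasure μ r A)) :
    ∑' x : A, ENNReal.ofReal (u x ^ 2) * μ (Metric.ball (x : X) (r / 4)) < ∞ := by
  have h := lintegral_rpow_enorm_lt_top_of_eLpNorm_lt_top two_ne_zero ENNReal.ofNat_ne_top hu.2
  rw [lintegral_discreteMeasure] at h
  simpa [Real.enorm_eq_ofReal_abs, ← ENNReal.ofReal_pow] using h

end Energy

end

end GraphApprox

/-! ### Assembly of the extension estimates -/

theorem theorem1p2 {X : Type*} [MetricSpace X] [CompleteSpace X] [MeasurableSpace X] [BorelSpace X]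
    (μ : MeasureTheory.Measure X) (hμ : GraphApprox.IsDoubling μ)
    (hP : GraphApprox.SupportsPoincare 2 μ)
    (Ω : Set X) (hΩo : IsOpen Ω) (hΩc : IsConnected Ω) (hΩb : Bornology.IsBounded Ω)
    (hΩ : 0 < μ Ωᶜ) :
    ∃ C : ℝ, 1 ≤ C ∧ ∀ r : ℝ, 0 < r → ∀ Xr : Set X, GraphApprox.IsDiscretization r Xr →
      ∃ P : (Xr → ℝ) → (X → ℝ),
        -- `P` maps `L²(X_r)` to `N^{1,2}(X)`
        (∀ u : Xr → ℝ, MeasureTheory.MemLp u 2 (GraphApprox.discreteMeasure μ r Xr) →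
          GraphApprox.MemNewtonSobolev 2 μ (P u)) ∧
        -- (a), for every function on `X_r`
        (∀ u : Xr → ℝ, MeasureTheory.LocallyIntegrable (P u) μ ∧
          ∀ x : Xr, GraphApprox.ballAverage μ r Xr (P u) x = u x) ∧
        -- (b), for the infimum over upper gradients and for the minimal 2-weak upper gradient
        (∀ u : Xr → ℝ,
          GraphApprox.upperGradientEnergy 2 μ (P u) ≤
            ENNReal.ofReal C * GraphApprox.graphEnergy μ r Xr u ∧
          ∀ g : X → ENNReal, GraphApprox.IsMinimalWeakUpperGradient 2 μ (P u) g →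
            ∫⁻ x, g x ^ (2 : ℝ) ∂μ ≤ ENNReal.ofReal C * GraphApprox.graphEnergy μ r Xr u) ∧
        -- (c)
        (∀ u : Xr → ℝ, GraphApprox.MemDiscreteZero r Xr Ω u →
          GraphApprox.MemNewtonSobolevZero 2 μ Ω (P u)) := by
  obtain ⟨C, hC1, hC⟩ := hμ.exists_upperGradient_extension
  have := hμ.isLocallyFiniteMeasure
  refine ⟨C, hC1, fun r hr A hA => ⟨GraphApprox.extension r A, fun u hu => ?_, fun u => ⟨?_, ?_⟩,
    fun u => ?_, fun u hu => ?_⟩⟩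
  · exact GraphApprox.memNewtonSobolev_extension hμ hr hA (GraphApprox.tsum_lt_top_of_memLp hu)
  · exact (GraphApprox.continuous_extension hμ hr hA u).locallyIntegrable
  · exact GraphApprox.ballAverage_extension hμ hr hA u
  -- The same `g₀` is a competitor for the infimum and for the minimal weak upper gradient.
  · obtain ⟨g₀, hg₀, hE⟩ := hC r hr A hA u
    exact ⟨(iInf₂_le g₀ hg₀).trans hE, fun g hg => (hg.lintegral_le two_pos hg₀).trans hE⟩
  · exact GraphApprox.memNewtonSobolevZero_extension hμ hr hA hΩb hu
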